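/- Let $K$ be a field of characteristic $0$. For a non-zero polynomial $f$ in finitely many variables $x_i$ over $K$, let $D$ be the Weyl algebra generated over $K$ by these $x_i$ and $\partial_i$, let $D[s]$ be the polynomial ring over $D$ in a central variable $s$, and let $M=K[x][s,\tfrac1f]\cdot f^s$ be the free $K[x][s,\tfrac1f]$-module of rank one on the symbol $f^s$. It is a left $D[s]$-module, where $x_i$ and $s$ act by multiplication and $$\partial_i\,(g\cdot f^s)=\Big(\frac{\partial g}{\partial x_i}+s\,g\,\frac{\partial f}{\partial x_i}\,\frac1f\Big)\cdot f^s .$$ The Bernstein-Sato polynomial $b_f(s)\in K[s]$ is the monic polynomial $b(s)$ of minimal degree for which there is $P(s)\in D[s]$ with $P(s)f\cdot f^s=b(s)\cdot f^s$ in $M$. Let $F\in K[x_1,\dots,x_n]$ be a non-zero polynomial that is quasi-homogeneous for the weights $w=(w_1,\dots,w_n)\in K^n$, that is, $\sum_{i=1}^n w_i x_i\,\dfrac{\partial F}{\partial x_i}=F$. Let $k\in\{1,\dots,n\}$ with $w_k\neq 0$, let $c\in K^*$, and let $f=F|_{x_k=c}$ be obtained from $F$ by substituting $x_k=c$. Then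 $b_f(s)$ divides $b_F(s)$, both when $f$ is regarded as a polynomial in the variables $x_i$ with $i\neq k$ and when it is regarded as a polynomial in $x_1,\dots,x_n$. -/

import Mathlib

open scoped Polynomial

noncomputable section

namespace BernsteinSato

/-- The generators of the Weyl algebra: the multiplication operators `x i` and the partial
derivatives `d i`. -/
inductive WeylGen (σ : Type*) where
  | x (i : σ) : WeylGen σ
  | d (i : σ) : WeylGen σ

/-- The defining relations of the Weyl algebra: `x_j x_i = x_i x_j`, `∂_j ∂_i = ∂_i ∂_j`,
`∂_i x_i = x_i ∂_i + 1`, and `∂_i x_j = x_j ∂_i` for `i ≠ j`. -/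
inductive WeylRel (σ K : Type*) [Field K] :
    FreeAlgebra K (WeylGen σ) → FreeAlgebra K (WeylGen σ) → Prop
  | x_comm (i j : σ) : WeylRel σ K
      (FreeAlgebra.ι K (WeylGen.x j) * FreeAlgebra.ι K (WeylGen.x i))
      (FreeAlgebra.ι K (WeylGen.x i) * FreeAlgebra.ι K (WeylGen.x j))
  | d_comm (i j : σ) : WeylRel σ K
      (FreeAlgebra.ι K (WeylGen.d j) * FreeAlgebra.ι K (WeylGen.d i))
      (FreeAlgebra.ι K (WeylGen.d i) * FreeAlgebra.ι K (WeylGen.d j))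
  | d_x_self (i : σ) : WeylRel σ K
      (FreeAlgebra.ι K (WeylGen.d i) * FreeAlgebra.ι K (WeylGen.x i))
      (FreeAlgebra.ι K (WeylGen.x i) * FreeAlgebra.ι K (WeylGen.d i) + 1)
  | d_x_of_ne (i j : σ) (h : i ≠ j) : WeylRel σ K
      (FreeAlgebra.ι K (WeylGen.d i) * FreeAlgebra.ι K (WeylGen.x j))
      (FreeAlgebra.ι K (WeylGen.x j) * FreeAlgebra.ι K (WeylGen.d i))

/-- The Weyl algebra over `K` in the variables `x i`, `i : σ`. -/
abbrev WeylAlgebra (σ K : Type*) [Field K] : Type _ := RingQuot (WeylRel σ K)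

variable {σ K : Type*} [Field K]

/-- The polynomial `f ∈ K[x]`, seen in `K[s][x] = K[x][s]`. -/
def baseS (f : MvPolynomial σ K) : MvPolynomial σ K[X] :=
  MvPolynomial.map Polynomial.C f

/-- The ring `K[x][s, 1/f]`. It is also the carrier of the free module `M = K[x][s, 1/f] · f^s` of
rank one, in which the element `g` stands for `g · f^s`. -/
abbrev BernsteinModule (f : MvPolynomial σ K) : Type _ :=
  Localization.Away (baseS f)

/-- The `K[s]`-linear derivation `∂/∂x_i` of `K[x][s, 1/f]`: the unique extension of the partial
derivative of `K[x][s]` (see `partialLoc_algebraMap`). -/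
def partialLoc (f : MvPolynomial σ K) (i : σ) :
    Derivation K[X] (BernsteinModule f) (BernsteinModule f) :=
  haveI : Algebra.FormallyEtale (MvPolynomial σ K[X]) (BernsteinModule f) :=
    Algebra.FormallyEtale.of_isLocalization (Submonoid.powers (baseS f))
  LinearMap.compDer
    ((LinearMap.liftBaseChange (BernsteinModule f)
        (((Algebra.linearMap (MvPolynomial σ K[X]) (BernsteinModule f)).compDer
          (MvPolynomial.pderiv i)).liftKaehlerDifferential)) ∘ₗ
      (KaehlerDifferential.tensorKaehlerEquivOfFormallyEtale K[X] (MvPolynomial σ K[X])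
        (BernsteinModule f)).symm.toLinearMap)
    (KaehlerDifferential.D K[X] (BernsteinModule f))

theorem partialLoc_algebraMap (f : MvPolynomial σ K) (i : σ) (g : MvPolynomial σ K[X]) :
    partialLoc f i (algebraMap _ (BernsteinModule f) g) =
      algebraMap _ (BernsteinModule f) (MvPolynomial.pderiv i g) := by
  have : Algebra.FormallyEtale (MvPolynomial σ K[X]) (BernsteinModule f) :=
    Algebra.FormallyEtale.of_isLocalization (Submonoid.powers (baseS f))
  simp [partialLoc, KaehlerDifferential.tensorKaehlerEquivOfFormallyEtale_symm_D_algebraMap]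

/-- `1/f` in `K[x][s, 1/f]`. -/
def invF (f : MvPolynomial σ K) : BernsteinModule f :=
  IsLocalization.Away.invSelf (baseS f)

theorem mul_invF (f : MvPolynomial σ K) :
    algebraMap (MvPolynomial σ K[X]) (BernsteinModule f) (baseS f) * invF f = 1 :=
  IsLocalization.Away.mul_invSelf (baseS f)

theorem derivation_eq_zero (f : MvPolynomial σ K)
    (δ : Derivation K[X] (BernsteinModule f) (BernsteinModule f))
    (h : ∀ g : MvPolynomial σ K[X], δ (algebraMap _ _ g) = 0) (m : BernsteinModule f) :
    δ m = 0 := by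
  obtain ⟨n, a, ha⟩ := IsLocalization.Away.surj (baseS f) m
  have hu : IsUnit (algebraMap (MvPolynomial σ K[X]) (BernsteinModule f) (baseS f) ^ n) :=
    (IsUnit.of_mul_eq_one _ (mul_invF f)).pow n
  have h1 := congrArg δ ha
  rw [Derivation.leibniz, h, ← map_pow, h, smul_zero, zero_add, smul_eq_mul, map_pow] at h1
  exact (hu.mul_right_eq_zero).1 h1

theorem partialLoc_comm (f : MvPolynomial σ K) (i j : σ) (g : BernsteinModule f) :
    partialLoc f j (partialLoc f i g) = partialLoc f i (partialLoc f j g) := by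
  have h := derivation_eq_zero f ⁅partialLoc f j, partialLoc f i⁆ (fun p => by
    have hp : (⁅MvPolynomial.pderiv (R := K[X]) j, MvPolynomial.pderiv (R := K[X]) i⁆ :
        Derivation K[X] (MvPolynomial σ K[X]) (MvPolynomial σ K[X])) = 0 := by
      classical
      ext k
      simp [Derivation.commutator_apply, MvPolynomial.pderiv_X, Pi.single_apply, apply_ite]
    have hp' := DFunLike.congr_fun hp p
    simp only [Derivation.commutator_apply, Derivation.zero_apply] at hp'
    simp only [Derivation.commutator_apply, partialLoc_algebraMap, ← map_sub, hp', map_zero]) g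
  rwa [Derivation.commutator_apply, sub_eq_zero] at h

theorem pderiv_comm (i j : σ) (p : MvPolynomial σ K) :
    MvPolynomial.pderiv j (MvPolynomial.pderiv i p) =
      MvPolynomial.pderiv i (MvPolynomial.pderiv j p) := by
  have hp : (⁅MvPolynomial.pderiv (R := K) j, MvPolynomial.pderiv (R := K) i⁆ :
      Derivation K (MvPolynomial σ K) (MvPolynomial σ K)) = 0 := by
    classical
    ext k
    simp [Derivation.commutator_apply, MvPolynomial.pderiv_X, Pi.single_apply, apply_ite]
  have hp' := DFunLike.congr_fun hp p
  rwa [Derivation.commutator_apply, Derivation.zero_apply, sub_eq_zero] at hp'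

theorem partialLoc_baseS (f p : MvPolynomial σ K) (i : σ) :
    partialLoc f i (algebraMap _ (BernsteinModule f) (baseS p)) =
      algebraMap _ (BernsteinModule f) (baseS (MvPolynomial.pderiv i p)) := by
  rw [partialLoc_algebraMap]
  unfold baseS
  rw [MvPolynomial.pderiv_map]

theorem partialLoc_invF (f : MvPolynomial σ K) (i : σ) :
    partialLoc f i (invF f) =
      -(algebraMap _ (BernsteinModule f) (baseS (MvPolynomial.pderiv i f)) * invF f * invF f) := by
  have h1 := congrArg (partialLoc f i) (mul_invF f)
  rw [Derivation.leibniz, Derivation.map_one_eq_zero, partialLoc_baseS, smul_eq_mul,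
    smul_eq_mul] at h1
  linear_combination (invF f) * h1 - partialLoc f i (invF f) * mul_invF f

/-- The coefficient `s (∂f/∂x_i) (1/f)`, the logarithmic derivative of `f^s`. -/
def logPartial (f : MvPolynomial σ K) (i : σ) : BernsteinModule f :=
  algebraMap K[X] (BernsteinModule f) Polynomial.X *
    algebraMap _ (BernsteinModule f) (baseS (MvPolynomial.pderiv i f)) * invF f

theorem partialLoc_logPartial (f : MvPolynomial σ K) (i j : σ) :
    partialLoc f j (logPartial f i) = partialLoc f i (logPartial f j) := by
  simp only [logPartial, Derivation.leibniz, partialLoc_baseS, partialLoc_invF, smul_eq_mul,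
    Derivation.map_algebraMap, pderiv_comm i j f]
  ring

/-- The action of a generator of the Weyl algebra on `M`: `x_i` acts by multiplication, and
`∂_i (g · f^s) = (∂g/∂x_i + s g (∂f/∂x_i) (1/f)) · f^s`. -/
def genAction (f : MvPolynomial σ K) : WeylGen σ → Module.End K[X] (BernsteinModule f)
  | .x i => LinearMap.mulLeft K[X]
      (algebraMap (MvPolynomial σ K[X]) (BernsteinModule f) (MvPolynomial.X i))
  | .d i => (partialLoc f i).toLinearMap + LinearMap.mulLeft K[X] (logPartial f i)

theorem genAction_x (f : MvPolynomial σ K) (i : σ) (g : BernsteinModule f) :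
    genAction f (.x i) g =
      algebraMap (MvPolynomial σ K[X]) (BernsteinModule f) (MvPolynomial.X i) * g := rfl

theorem genAction_d (f : MvPolynomial σ K) (i : σ) (g : BernsteinModule f) :
    genAction f (.d i) g = partialLoc f i g + logPartial f i * g := rfl

/-- The action of the Weyl algebra on `M`. -/
def weylAction (f : MvPolynomial σ K) :
    WeylAlgebra σ K →ₐ[K] Module.End K[X] (BernsteinModule f) :=
  RingQuot.liftAlgHom K ⟨FreeAlgebra.lift K (genAction f), by
    intro a b hab
    cases hab with
    | x_comm i j =>
      ext g
      simp only [map_mul, FreeAlgebra.lift_ι_apply, Module.End.mul_apply, genAction_x]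
      ring
    | d_comm i j =>
      ext g
      simp only [map_mul, FreeAlgebra.lift_ι_apply, Module.End.mul_apply, genAction_d, map_add,
        Derivation.leibniz, smul_eq_mul, partialLoc_comm f i j, partialLoc_logPartial f i j]
      ring
    | d_x_self i =>
      ext g
      simp only [map_mul, map_add, map_one, FreeAlgebra.lift_ι_apply, Module.End.mul_apply,
        genAction_d, genAction_x, Derivation.leibniz, smul_eq_mul, LinearMap.add_apply,
        Module.End.one_apply, partialLoc_algebraMap, MvPolynomial.pderiv_X_self]
      ring
    | d_x_of_ne i j h =>
      ext g
      simp only [map_mul, FreeAlgebra.lift_ι_apply, Module.End.mul_apply,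
        genAction_d, genAction_x, Derivation.leibniz, smul_eq_mul,
        partialLoc_algebraMap, MvPolynomial.pderiv_X_of_ne h.symm, map_zero, mul_add]
      ring⟩

/-- The action on `M` of `D[s]`, the ring of polynomials in a central variable `s` with
coefficients in the Weyl algebra `D`; the variable `s` acts by multiplication by `s`. -/
def weylSAction (f : MvPolynomial σ K) :
    (WeylAlgebra σ K)[X] →ₐ[K] Module.End K[X] (BernsteinModule f) :=
  Polynomial.eval₂AlgHom (weylAction f)
    (algebraMap K[X] (Module.End K[X] (BernsteinModule f)) Polynomial.X)
    (fun _ => Algebra.commute_algebraMap_right _ _)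

/-- The functional equation `P(s) f · f^s = b(s) · f^s` holds in `M` for some `P(s) ∈ D[s]`. -/
def SatisfiesFunctionalEquation (f : MvPolynomial σ K) (b : K[X]) : Prop :=
  ∃ P : (WeylAlgebra σ K)[X],
    weylSAction f P (algebraMap _ (BernsteinModule f) (baseS f)) =
      algebraMap K[X] (BernsteinModule f) b

/-- `b` is a monic polynomial of minimal degree that satisfies the functional equation
of `f`. -/
def IsBernsteinSato (f : MvPolynomial σ K) (b : K[X]) : Prop :=
  b.Monic ∧ SatisfiesFunctionalEquation f b ∧
    ∀ b' : K[X], b'.Monic → SatisfiesFunctionalEquation f b' → b.natDegree ≤ b'.natDegree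

open Classical in
/-- The Bernstein-Sato polynomial `b_f(s)` of `f`. (By Bernstein's theorem the first case always
occurs over a field of characteristic zero in finitely many variables.) -/
def bernsteinSato (f : MvPolynomial σ K) : K[X] :=
  if h : ∃ b, IsBernsteinSato f b then h.choose else 0

/-- `F` is quasi-homogeneous for the weights `w`: `F = ξ(F)` for `ξ = ∑ i, w i * x i * ∂_i`. -/
def IsQuasiHomogeneous [Fintype σ] (w : σ → K) (F : MvPolynomial σ K) : Prop :=
  ∑ i, MvPolynomial.C (w i) * MvPolynomial.X i * MvPolynomial.pderiv i F = F

open Classical in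
/-- The polynomial `F|_{x_k = c}` in the remaining variables `x_i`, `i ≠ k`. -/
def substVar (k : σ) (c : K) (F : MvPolynomial σ K) : MvPolynomial {i : σ // i ≠ k} K :=
  MvPolynomial.aeval
    (fun i => if h : i = k then MvPolynomial.C c else MvPolynomial.X ⟨i, h⟩) F

end BernsteinSato

end

noncomputable section

namespace BernsteinSato

variable {σ τ K : Type*} [Field K]

/-! ### The inclusion `K[x] → K[x][s]` -/

/-! Setting `x_k = c` gives a map `substLoc` from the module of `F` to that of `f`. It commutes with
`x_i` and `∂_i` for `i ≠ k` and turns `x_k` into the scalar `c`, but nothing on the side of `f`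
corresponds to `∂_k`. So a functional equation `P F·F^s = b·F^s` cannot simply be specialized.

The remedy is `specializeSubmodule`: the vectors `m` such that every `∂_k^n m` specializes into
`D[s] f·f^s`. Commutation rules make it stable under `D[s]` (`genAction_mem_specializeSubmodule`).
It contains `F·F^s` because the Euler relation `∑ w_i x_i ∂_i (F·F^s) = (s+1) F·F^s` can be solved
for `∂_k` once `x_k` has become the unit `c`, as `w_k ≠ 0` (`baseS_mem_specializeSubmodule`). Hence
it contains `P F·F^s = b·F^s`, and `n = 0` gives `b·f^s ∈ D[s] f·f^s`. So each functional equation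
of `F` holds for `f` with the same `b`, which yields divisibility (`bernsteinSato_dvd_of_imp`). -/

theorem baseS_mul (p q : MvPolynomial σ K) : baseS (p * q) = baseS p * baseS q :=
  map_mul (MvPolynomial.map Polynomial.C) p q

theorem baseS_sum {ι : Type*} (t : Finset ι) (p : ι → MvPolynomial σ K) :
    baseS (∑ i ∈ t, p i) = ∑ i ∈ t, baseS (p i) :=
  map_sum (MvPolynomial.map Polynomial.C) p t

theorem baseS_C (a : K) :
    baseS (MvPolynomial.C a : MvPolynomial σ K) = MvPolynomial.C (Polynomial.C a) :=
  MvPolynomial.map_C _ _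

theorem baseS_X (i : σ) : baseS (MvPolynomial.X i : MvPolynomial σ K) = MvPolynomial.X i :=
  MvPolynomial.map_X _ _

/-! ### The `D[s]`-submodule generated by `f · f^s` -/

theorem weylSAction_C_ι (f : MvPolynomial σ K) (t : WeylGen σ) :
    weylSAction f (Polynomial.C (RingQuot.mkAlgHom K (WeylRel σ K) (FreeAlgebra.ι K t))) =
      genAction f t := by
  simp [weylSAction, weylAction]

theorem weylSAction_C_algebraMap (f : MvPolynomial σ K) (a : K) :
    weylSAction f (Polynomial.C (algebraMap K (WeylAlgebra σ K) a)) =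
      algebraMap K (Module.End K[X] (BernsteinModule f)) a := by
  simp [weylSAction]

theorem weylSAction_X (f : MvPolynomial σ K) :
    weylSAction f Polynomial.X =
      algebraMap K[X] (Module.End K[X] (BernsteinModule f)) Polynomial.X := by
  simp [weylSAction]

theorem weylSAction_aeval_X (f : MvPolynomial σ K) (p : K[X]) :
    weylSAction f (Polynomial.aeval Polynomial.X p) =
      algebraMap K[X] (Module.End K[X] (BernsteinModule f)) p := by
  rw [← Polynomial.aeval_algHom_apply, weylSAction_X, Polynomial.aeval_algebraMap_apply,
    Polynomial.aeval_X_left_apply]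

/-- A `K[s]`-submodule of `M` that is stable under the generators of the Weyl algebra is stable
under `D[s]`. -/
theorem weylSAction_mem (f : MvPolynomial σ K) (N : Submodule K[X] (BernsteinModule f))
    (hN : ∀ t, ∀ m ∈ N, genAction f t m ∈ N) (P : (WeylAlgebra σ K)[X]) :
    ∀ m ∈ N, weylSAction f P m ∈ N := by
  have hC : ∀ a : FreeAlgebra K (WeylGen σ), ∀ m ∈ N,
      weylSAction f (Polynomial.C (RingQuot.mkAlgHom K (WeylRel σ K) a)) m ∈ N := by
    intro a
    induction a using FreeAlgebra.induction with
    | grade0 r =>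
      intro m hm
      rw [AlgHom.commutes, weylSAction_C_algebraMap, Module.algebraMap_end_apply,
        ← algebraMap_smul K[X] r m]
      exact N.smul_mem _ hm
    | grade1 t =>
      intro m hm
      rw [weylSAction_C_ι]
      exact hN t m hm
    | mul a b ha hb =>
      intro m hm
      rw [map_mul, map_mul, map_mul, Module.End.mul_apply]
      exact ha _ (hb m hm)
    | add a b ha hb =>
      intro m hm
      rw [map_add, map_add, map_add, LinearMap.add_apply]
      exact N.add_mem (ha m hm) (hb m hm)
  induction P using Polynomial.induction_on' with
  | add p q hp hq =>
    intro m hm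
    rw [map_add, LinearMap.add_apply]
    exact N.add_mem (hp m hm) (hq m hm)
  | monomial n a =>
    intro m hm
    obtain ⟨a, rfl⟩ := RingQuot.mkAlgHom_surjective K (WeylRel σ K) a
    rw [← Polynomial.C_mul_X_pow_eq_monomial, map_mul, map_pow, weylSAction_X, ← map_pow,
      Module.End.mul_apply, Module.algebraMap_end_apply]
    exact hC a _ (N.smul_mem _ hm)

/-- The `D[s]`-submodule of `M` generated by `f · f^s`. -/
def cyclicSubmodule (f : MvPolynomial σ K) : Submodule K[X] (BernsteinModule f) where
  carrier := {m | ∃ P, weylSAction f P (algebraMap _ (BernsteinModule f) (baseS f)) = m}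
  zero_mem' := ⟨0, by rw [map_zero, LinearMap.zero_apply]⟩
  add_mem' := by
    rintro _ _ ⟨P, rfl⟩ ⟨Q, rfl⟩
    exact ⟨P + Q, by rw [map_add, LinearMap.add_apply]⟩
  smul_mem' := by
    rintro p _ ⟨P, rfl⟩
    -- The scalar `p ∈ K[s]` is realized by the element `p(s)` of `D[s]`.
    exact ⟨Polynomial.aeval Polynomial.X p * P, by
      rw [map_mul, weylSAction_aeval_X, Module.End.mul_apply, Module.algebraMap_end_apply]⟩

theorem satisfiesFunctionalEquation_iff (f : MvPolynomial σ K) (b : K[X]) :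
    SatisfiesFunctionalEquation f b ↔
      algebraMap K[X] (BernsteinModule f) b ∈ cyclicSubmodule f := Iff.rfl

theorem baseS_mem_cyclicSubmodule (f : MvPolynomial σ K) :
    algebraMap _ (BernsteinModule f) (baseS f) ∈ cyclicSubmodule f :=
  ⟨1, by rw [map_one, Module.End.one_apply]⟩

theorem genAction_mem_cyclicSubmodule (f : MvPolynomial σ K) (t : WeylGen σ)
    {m : BernsteinModule f} (hm : m ∈ cyclicSubmodule f) :
    genAction f t m ∈ cyclicSubmodule f := by
  obtain ⟨P, rfl⟩ := hm
  exact ⟨Polynomial.C (RingQuot.mkAlgHom K (WeylRel σ K) (FreeAlgebra.ι K t)) * P, by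
    rw [map_mul, weylSAction_C_ι, Module.End.mul_apply]⟩

/-! ### The Bernstein-Sato polynomial generates the ideal of functional equations -/

/-- The solutions form an ideal of `K[s]`, so a non-zero remainder modulo `b`, made monic, would be
a solution of smaller degree. -/
theorem IsBernsteinSato.dvd {f : MvPolynomial σ K} {b b' : K[X]} (hb : IsBernsteinSato f b)
    (hb' : SatisfiesFunctionalEquation f b') : b ∣ b' := by
  obtain ⟨hm, hs, hmin⟩ := hb
  rw [← Polynomial.modByMonic_eq_zero_iff_dvd hm]
  by_contra hr
  set r := b' %ₘ b with hrdef
  have hlc : r.leadingCoeff⁻¹ ≠ 0 := inv_ne_zero (Polynomial.leadingCoeff_ne_zero.2 hr)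
  have hsr : SatisfiesFunctionalEquation f (r * Polynomial.C r.leadingCoeff⁻¹) := by
    rw [satisfiesFunctionalEquation_iff] at *
    have e : r * Polynomial.C r.leadingCoeff⁻¹ = Polynomial.C r.leadingCoeff⁻¹ * b' -
        (Polynomial.C r.leadingCoeff⁻¹ * (b' /ₘ b)) * b := by
      linear_combination Polynomial.C r.leadingCoeff⁻¹ * Polynomial.modByMonic_add_div b' b
    rw [e, map_sub, map_mul _ _ b', map_mul _ _ b, ← Algebra.smul_def, ← Algebra.smul_def]
    exact Submodule.sub_mem _ (Submodule.smul_mem _ _ hb') (Submodule.smul_mem _ _ hs)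
  have h1 := hmin _ (Polynomial.monic_mul_leadingCoeff_inv hr) hsr
  rw [Polynomial.natDegree_mul_C hlc] at h1
  have h2 := Polynomial.degree_modByMonic_lt b' hm
  exact absurd (Polynomial.natDegree_lt_natDegree hr h2) (not_lt.2 h1)

theorem exists_isBernsteinSato {f : MvPolynomial σ K} {b : K[X]} (hm : b.Monic)
    (hb : SatisfiesFunctionalEquation f b) : ∃ b', IsBernsteinSato f b' := by
  obtain ⟨b', ⟨h1, h2⟩, h3⟩ :=
    exists_minimalFor_of_wellFoundedLT
      (fun p : K[X] => p.Monic ∧ SatisfiesFunctionalEquation f p) Polynomial.natDegree ⟨b, hm, hb⟩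
  exact ⟨b', h1, h2, fun q hq hq' => (le_total _ _).elim id (h3 ⟨hq, hq'⟩)⟩

theorem isBernsteinSato_bernsteinSato {f : MvPolynomial σ K} (h : ∃ b, IsBernsteinSato f b) :
    IsBernsteinSato f (bernsteinSato f) := by
  rw [bernsteinSato, dif_pos h]
  exact h.choose_spec

theorem bernsteinSato_dvd_of_imp {f : MvPolynomial σ K} {F : MvPolynomial τ K}
    (h : ∀ b, SatisfiesFunctionalEquation F b → SatisfiesFunctionalEquation f b) :
    bernsteinSato f ∣ bernsteinSato F := by
  by_cases hF : ∃ b, IsBernsteinSato F b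
  · obtain ⟨hm, hs, -⟩ := isBernsteinSato_bernsteinSato hF
    exact (isBernsteinSato_bernsteinSato (exists_isBernsteinSato hm (h _ hs))).dvd (h _ hs)
  -- Without a solution for `F`, the default value `0` is divisible by anything.
  · rw [bernsteinSato.eq_def F, dif_neg hF]
    exact dvd_zero _

/-! ### Substitution of polynomials, extended to `K[x][s, 1/f]` -/

/-- The `K[s]`-linear extension `K[x][s] → K[y][s]` of the substitution `x_i = g_i`. -/
def substS (g : σ → MvPolynomial τ K) : MvPolynomial σ K[X] →ₐ[K[X]] MvPolynomial τ K[X] :=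
  MvPolynomial.aeval fun i => baseS (g i)

theorem substS_X (g : σ → MvPolynomial τ K) (i : σ) :
    substS g (MvPolynomial.X i) = baseS (g i) := by
  simp [substS]

theorem substS_baseS (g : σ → MvPolynomial τ K) (F : MvPolynomial σ K) :
    substS g (baseS F) = baseS (MvPolynomial.aeval g F) := by
  induction F using MvPolynomial.induction_on with
  | C a => simp [baseS, substS, MvPolynomial.algebraMap_eq]
  | add p q hp hq => simp only [baseS, map_add] at *; rw [hp, hq]
  | mul_X p i hp => simp only [baseS, map_mul, MvPolynomial.map_X, MvPolynomial.aeval_X] at *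
                    rw [hp, substS_X, baseS]

theorem isUnit_algebraMap_substS (g : σ → MvPolynomial τ K) (F : MvPolynomial σ K) :
    IsUnit (((algebraMap (MvPolynomial τ K[X])
      (BernsteinModule (MvPolynomial.aeval g F : MvPolynomial τ K))).comp
        (substS g : MvPolynomial σ K[X] →+* MvPolynomial τ K[X])) (baseS F)) := by
  rw [RingHom.comp_apply, RingHom.coe_coe, substS_baseS]
  exact IsUnit.of_mul_eq_one _ (mul_invF _)

/-- The substitution `x_i = g_i` as a map `K[x][s, 1/F] → K[y][s, 1/f]` for `f = F(g)`. -/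
def substLoc (g : σ → MvPolynomial τ K) (F : MvPolynomial σ K) :
    BernsteinModule F →+* BernsteinModule (MvPolynomial.aeval g F : MvPolynomial τ K) :=
  IsLocalization.Away.lift (baseS F) (isUnit_algebraMap_substS g F)

theorem substLoc_algebraMap (g : σ → MvPolynomial τ K) (F : MvPolynomial σ K)
    (p : MvPolynomial σ K[X]) :
    substLoc g F (algebraMap _ _ p) = algebraMap _ _ (substS g p) :=
  IsLocalization.Away.lift_eq (baseS F) (isUnit_algebraMap_substS g F) p

theorem substLoc_algebraMap_polynomial (g : σ → MvPolynomial τ K) (F : MvPolynomial σ K)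
    (p : K[X]) : substLoc g F (algebraMap _ _ p) = algebraMap _ _ p := by
  rw [IsScalarTower.algebraMap_apply K[X] (MvPolynomial σ K[X]) (BernsteinModule F),
    substLoc_algebraMap, AlgHom.commutes, ← IsScalarTower.algebraMap_apply]

theorem substLoc_smul (g : σ → MvPolynomial τ K) (F : MvPolynomial σ K)
    (p : K[X]) (m : BernsteinModule F) : substLoc g F (p • m) = p • substLoc g F m := by
  rw [Algebra.smul_def, map_mul, substLoc_algebraMap_polynomial, ← Algebra.smul_def]

theorem substLoc_baseS (g : σ → MvPolynomial τ K) (F p : MvPolynomial σ K) :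
    substLoc g F (algebraMap _ _ (baseS p)) =
      algebraMap _ _ (baseS (MvPolynomial.aeval g p)) := by
  rw [substLoc_algebraMap, substS_baseS]

theorem substLoc_invF (g : σ → MvPolynomial τ K) (F : MvPolynomial σ K) :
    substLoc g F (invF F) = invF _ := by
  have h1 := congrArg (substLoc g F) (mul_invF F)
  rw [map_mul, substLoc_baseS, map_one] at h1
  linear_combination invF _ * h1 - substLoc g F (invF F) * mul_invF (MvPolynomial.aeval g F)

/-- Both sides are derivations along `substLoc` and agree on `K[x][s]`; multiplying by a power of
`F`, whose image is a unit, reduces to that case. -/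
theorem substLoc_partialLoc {g : σ → MvPolynomial τ K} {F : MvPolynomial σ K} {i : σ} {j : τ}
    (h : ∀ p, MvPolynomial.pderiv j (substS g p) = substS g (MvPolynomial.pderiv i p))
    (m : BernsteinModule F) :
    substLoc g F (partialLoc F i m) = partialLoc _ j (substLoc g F m) := by
  have h0 : ∀ p : MvPolynomial σ K[X], substLoc g F (partialLoc F i (algebraMap _ _ p)) =
      partialLoc _ j (substLoc g F (algebraMap _ _ p)) := fun p => by
    rw [partialLoc_algebraMap, substLoc_algebraMap, substLoc_algebraMap, partialLoc_algebraMap, h]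
  obtain ⟨n, a, ha⟩ := IsLocalization.Away.surj (baseS F) m
  have hu : IsUnit (substLoc g F
      (algebraMap (MvPolynomial σ K[X]) (BernsteinModule F) (baseS F) ^ n)) :=
    ((IsUnit.of_mul_eq_one _ (mul_invF F)).pow n).map _
  have h1 := h0 a
  have h2 := h0 (baseS F ^ n)
  rw [← ha] at h1
  simp only [map_pow] at h2
  simp only [map_mul, map_add, Derivation.leibniz _ m, Derivation.leibniz _ (substLoc g F m),
    smul_eq_mul, map_pow] at h1
  rw [map_pow] at hu
  refine hu.mul_left_cancel ?_
  linear_combination h1 - substLoc g F m * h2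

theorem baseS_aeval_pderiv {g : σ → MvPolynomial τ K} {i : σ} {j : τ}
    (h : ∀ p, MvPolynomial.pderiv j (substS g p) = substS g (MvPolynomial.pderiv i p))
    (F : MvPolynomial σ K) :
    baseS (MvPolynomial.aeval g (MvPolynomial.pderiv i F)) =
      baseS (MvPolynomial.pderiv j (MvPolynomial.aeval g F)) := by
  have h1 := h (baseS F)
  rw [substS_baseS] at h1
  rw [← substS_baseS]
  unfold baseS at *
  rw [← MvPolynomial.pderiv_map, ← MvPolynomial.pderiv_map, h1]

theorem substLoc_genAction_d {g : σ → MvPolynomial τ K} {F : MvPolynomial σ K} {i : σ} {j : τ}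
    (h : ∀ p, MvPolynomial.pderiv j (substS g p) = substS g (MvPolynomial.pderiv i p))
    (m : BernsteinModule F) :
    substLoc g F (genAction F (.d i) m) = genAction _ (.d j) (substLoc g F m) := by
  rw [genAction_d, genAction_d, map_add, map_mul, substLoc_partialLoc h, logPartial, logPartial,
    map_mul, map_mul, substLoc_baseS, substLoc_invF, substLoc_algebraMap_polynomial,
    baseS_aeval_pderiv h]

theorem substLoc_genAction_x (g : σ → MvPolynomial τ K) (F : MvPolynomial σ K) (i : σ)
    (m : BernsteinModule F) :
    substLoc g F (genAction F (.x i) m) = algebraMap _ _ (baseS (g i)) * substLoc g F m := by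
  rw [genAction_x, map_mul, substLoc_algebraMap, substS_X]

/-! ### Commutation rules on `M` -/

theorem genAction_d_x_of_ne (f : MvPolynomial σ K) {i j : σ} (h : i ≠ j) (m : BernsteinModule f) :
    genAction f (.d i) (genAction f (.x j) m) = genAction f (.x j) (genAction f (.d i) m) := by
  simp only [genAction_d, genAction_x, Derivation.leibniz, smul_eq_mul,
    partialLoc_algebraMap, MvPolynomial.pderiv_X_of_ne h.symm, map_zero, mul_add]
  ring

theorem genAction_d_x_self (f : MvPolynomial σ K) (i : σ) (m : BernsteinModule f) :
    genAction f (.d i) (genAction f (.x i) m) = genAction f (.x i) (genAction f (.d i) m) + m := by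
  simp only [genAction_d, genAction_x, Derivation.leibniz, smul_eq_mul,
    partialLoc_algebraMap, MvPolynomial.pderiv_X_self, map_one]
  ring

theorem genAction_d_d (f : MvPolynomial σ K) (i j : σ) (m : BernsteinModule f) :
    genAction f (.d i) (genAction f (.d j) m) = genAction f (.d j) (genAction f (.d i) m) := by
  simp only [genAction_d, map_add, Derivation.leibniz, smul_eq_mul, partialLoc_comm f i j,
    partialLoc_logPartial f i j]
  ring

/-- The commutator `[∂^(n+1), x] = (n+1) ∂^n`, indexed so as to avoid subtraction in `ℕ`. -/
theorem iterate_genAction_d_x_self (f : MvPolynomial σ K) (i : σ) (n : ℕ)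
    (m : BernsteinModule f) :
    (genAction f (.d i) ^ (n + 1)) (genAction f (.x i) m) =
      genAction f (.x i) ((genAction f (.d i) ^ (n + 1)) m) +
        ((n + 1 : ℕ) : K[X]) • (genAction f (.d i) ^ n) m := by
  induction n with
  | zero => simp [genAction_d_x_self]
  | succ n ih =>
    rw [pow_succ', Module.End.mul_apply, ih, map_add, map_smul, genAction_d_x_self,
      ← Module.End.mul_apply (genAction f (.d i)) (genAction f (.d i) ^ n), ← pow_succ',
      ← Module.End.mul_apply (genAction f (.d i)) (genAction f (.d i) ^ (n + 1)), ← pow_succ',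
      Nat.cast_succ (n + 1), add_smul, one_smul]
    abel

/-- `∂_i` applied to `f · f^s` is `(s + 1) (∂f/∂x_i) · f^s`. -/
theorem genAction_d_baseS (f : MvPolynomial σ K) (i : σ) :
    genAction f (.d i) (algebraMap _ _ (baseS f)) =
      (Polynomial.X + 1 : K[X]) • algebraMap _ _ (baseS (MvPolynomial.pderiv i f)) := by
  rw [genAction_d, partialLoc_baseS, logPartial, Algebra.smul_def, map_add, map_one]
  linear_combination algebraMap K[X] (BernsteinModule f) Polynomial.X *
    algebraMap _ _ (baseS (MvPolynomial.pderiv i f)) * mul_invF f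

/-- The Euler field `∑ i, w i * x i * ∂_i` multiplies `F · F^s` by `s + 1`. -/
theorem IsQuasiHomogeneous.sum_genAction [Fintype σ] {w : σ → K} {F : MvPolynomial σ K}
    (hw : IsQuasiHomogeneous w F) :
    ∑ i, Polynomial.C (w i) • genAction F (.x i)
        (genAction F (.d i) (algebraMap _ _ (baseS F))) =
      (Polynomial.X + 1 : K[X]) • algebraMap _ (BernsteinModule F) (baseS F) := by
  have h := congrArg (fun p => algebraMap _ (BernsteinModule F) (baseS p)) hw
  simp only [baseS_sum, baseS_mul, baseS_C, baseS_X, map_sum, map_mul] at h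
  rw [← h, Finset.smul_sum]
  refine Finset.sum_congr rfl fun i _ => ?_
  have hC : algebraMap (MvPolynomial σ K[X]) (BernsteinModule F)
      (MvPolynomial.C (Polynomial.C (w i))) = algebraMap K[X] _ (Polynomial.C (w i)) := by
    rw [IsScalarTower.algebraMap_apply K[X] (MvPolynomial σ K[X]) (BernsteinModule F),
      MvPolynomial.algebraMap_eq]
  -- The earlier rewrite with `← h` also expanded `F` inside the left-hand summands; this folds it
  -- back.
  rw [h, genAction_d_baseS, map_smul, genAction_x, hC]
  simp only [Algebra.smul_def]
  ring

/-! ### Specialization of a variable -/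

section Specialize

variable {k : σ} {c : K} {g : σ → MvPolynomial τ K} {e : {i : σ // i ≠ k} → τ}

/-- By the Leibniz rule it is enough to check variables: `x_k` becomes a constant, and the others
stay distinct variables. Allowing any injective `e` covers both choices of ambient ring for `f`. -/
theorem pderiv_substS (he : Function.Injective e) (hgk : g k = MvPolynomial.C c)
    (hg : ∀ i : {i : σ // i ≠ k}, g i = MvPolynomial.X (e i)) (i : {i : σ // i ≠ k})
    (p : MvPolynomial σ K[X]) :
    MvPolynomial.pderiv (e i) (substS g p) = substS g (MvPolynomial.pderiv (i : σ) p) := by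
  classical
  have hX : ∀ j, MvPolynomial.pderiv (e i) (baseS (g j)) =
      substS g (MvPolynomial.pderiv (i : σ) (MvPolynomial.X j)) := by
    intro j
    by_cases hj : j = k
    · subst hj
      rw [hgk, MvPolynomial.pderiv_X_of_ne (Ne.symm i.2), map_zero]
      simp [baseS]
    · rw [hg ⟨j, hj⟩, baseS_X, MvPolynomial.pderiv_X, MvPolynomial.pderiv_X]
      by_cases hij : (i : σ) = j
      · have : i = ⟨j, hj⟩ := Subtype.ext hij
        subst this
        simp
      · have : e i ≠ e ⟨j, hj⟩ := fun h => hij (congrArg Subtype.val (he h))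
        simp [this.symm, Ne.symm hij]
  induction p using MvPolynomial.induction_on with
  | C a => simp [substS, MvPolynomial.algebraMap_eq]
  | add p q hp hq => simp only [map_add, hp, hq]
  | mul_X p j hp =>
    simp only [map_mul, Derivation.leibniz, map_add, smul_eq_mul, hp, substS_X, hX]

/-- The vectors all of whose `∂_k`-derivatives specialize into the `D[s]`-submodule generated by
`f · f^s`, where `f` is the specialization of `F`. -/
def specializeSubmodule (g : σ → MvPolynomial τ K) (F : MvPolynomial σ K) (k : σ) :
    Submodule K[X] (BernsteinModule F) where
  carrier := {m | ∀ n, substLoc g F ((genAction F (.d k) ^ n) m) ∈ cyclicSubmodule _}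
  zero_mem' n := by
    rw [map_zero, map_zero]
    exact Submodule.zero_mem _
  add_mem' ha hb n := by
    rw [map_add, map_add]
    exact Submodule.add_mem _ (ha n) (hb n)
  smul_mem' p m hm n := by
    rw [map_smul, substLoc_smul]
    exact Submodule.smul_mem _ _ (hm n)

theorem algebraMap_baseS_C_mul (f : MvPolynomial τ K) (c : K) (m : BernsteinModule f) :
    algebraMap (MvPolynomial τ K[X]) _ (baseS (MvPolynomial.C c)) * m = Polynomial.C c • m := by
  rw [baseS_C, ← MvPolynomial.algebraMap_eq,
    ← IsScalarTower.algebraMap_apply, ← Algebra.smul_def]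

theorem substLoc_genAction_x_mem (hgk : g k = MvPolynomial.C c)
    (hg : ∀ i : {i : σ // i ≠ k}, g i = MvPolynomial.X (e i)) {F : MvPolynomial σ K} (i : σ)
    {m : BernsteinModule F} (hm : substLoc g F m ∈ cyclicSubmodule _) :
    substLoc g F (genAction F (.x i) m) ∈ cyclicSubmodule _ := by
  rw [substLoc_genAction_x]
  by_cases hi : i = k
  · rw [hi, hgk, algebraMap_baseS_C_mul]
    exact Submodule.smul_mem _ _ hm
  · rw [hg ⟨i, hi⟩, baseS_X, ← genAction_x]
    exact genAction_mem_cyclicSubmodule _ _ hm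

theorem substLoc_genAction_d_mem (he : Function.Injective e) (hgk : g k = MvPolynomial.C c)
    (hg : ∀ i : {i : σ // i ≠ k}, g i = MvPolynomial.X (e i)) {F : MvPolynomial σ K} {i : σ}
    (hi : i ≠ k) {m : BernsteinModule F} (hm : substLoc g F m ∈ cyclicSubmodule _) :
    substLoc g F (genAction F (.d i) m) ∈ cyclicSubmodule _ := by
  rw [substLoc_genAction_d (pderiv_substS he hgk hg ⟨i, hi⟩)]
  exact genAction_mem_cyclicSubmodule _ _ hm

theorem iterate_genAction_d_comm {F : MvPolynomial σ K} {t : WeylGen σ} (n : ℕ)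
    (h : ∀ m, genAction F (.d k) (genAction F t m) = genAction F t (genAction F (.d k) m))
    (m : BernsteinModule F) :
    (genAction F (.d k) ^ n) (genAction F t m) = genAction F t ((genAction F (.d k) ^ n) m) :=
  LinearMap.congr_fun (Commute.pow_left (LinearMap.ext h :
    Commute (genAction F (.d k)) (genAction F t)) n) m

/-- Applying `∂_k` only shifts `n`, and `x_i`, `∂_i` with `i ≠ k` commute with `∂_k^n`. Moving `x_k`
past `∂_k^n` costs a multiple of `∂_k^(n-1)`, which is also controlled; this is why all powers are
required at once. -/
theorem genAction_mem_specializeSubmodule (he : Function.Injective e)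
    (hgk : g k = MvPolynomial.C c)
    (hg : ∀ i : {i : σ // i ≠ k}, g i = MvPolynomial.X (e i)) {F : MvPolynomial σ K}
    (t : WeylGen σ) (m : BernsteinModule F) (hm : m ∈ specializeSubmodule g F k) :
    genAction F t m ∈ specializeSubmodule g F k := by
  intro n
  cases t with
  | x i =>
    by_cases hi : i = k
    · subst hi
      cases n with
      | zero => exact substLoc_genAction_x_mem hgk hg _ (hm 0)
      | succ n =>
        rw [iterate_genAction_d_x_self, map_add, substLoc_smul]
        exact Submodule.add_mem _ (substLoc_genAction_x_mem hgk hg _ (hm _))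
          (Submodule.smul_mem _ _ (hm n))
    · rw [iterate_genAction_d_comm n (genAction_d_x_of_ne F (Ne.symm hi))]
      exact substLoc_genAction_x_mem hgk hg _ (hm n)
  | d i =>
    by_cases hi : i = k
    · subst hi
      rw [← Module.End.mul_apply, ← pow_succ]
      exact hm _
    · rw [iterate_genAction_d_comm n (genAction_d_d F k i)]
      exact substLoc_genAction_d_mem he hgk hg hi (hm n)

/-- Induction on `n`: applying `∂_k^n` to the Euler relation and specializing expresses `w_k c
∂_k^(n+1) u` through `∂_k^n u` and its images under `x_i ∂_i`, `i ≠ k`. -/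
theorem baseS_mem_specializeSubmodule [Fintype σ] (he : Function.Injective e)
    (hgk : g k = MvPolynomial.C c)
    (hg : ∀ i : {i : σ // i ≠ k}, g i = MvPolynomial.X (e i)) (hc : c ≠ 0)
    {w : σ → K} {F : MvPolynomial σ K} (hw : IsQuasiHomogeneous w F) (hk : w k ≠ 0) :
    algebraMap _ _ (baseS F) ∈ specializeSubmodule g F k := by
  classical
  set u : BernsteinModule F := algebraMap _ _ (baseS F) with hu
  intro n
  induction n with
  | zero =>
    rw [pow_zero, Module.End.one_apply, hu, substLoc_baseS]
    exact baseS_mem_cyclicSubmodule _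
  | succ n ih =>
    set v := (genAction F (.d k) ^ n) u with hv
    have hsucc : (genAction F (.d k) ^ (n + 1)) u = genAction F (.d k) v := by
      rw [pow_succ', Module.End.mul_apply]
    -- The correction `n ∂_k^(n-1)` acts on `∂_k u`, hence gives back `n v`.
    have hx : (genAction F (.d k) ^ n) (genAction F (.x k) (genAction F (.d k) u)) =
        genAction F (.x k) (genAction F (.d k) v) + (n : K[X]) • v := by
      cases n with
      | zero => simp [hv]
      | succ n =>
        rw [iterate_genAction_d_x_self, ← hsucc, hv, pow_succ _ (n + 1), pow_succ _ n]
        simp only [Module.End.mul_apply]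
    have hE := congrArg (genAction F (.d k) ^ n) hw.sum_genAction
    rw [← hu, ← Finset.add_sum_erase _ _ (Finset.mem_univ k), map_add, map_smul, map_smul, hx,
      map_sum, ← hv] at hE
    have hE' := congrArg (substLoc g F) hE
    rw [map_add, substLoc_smul, substLoc_smul, map_add, substLoc_smul, substLoc_genAction_x, hgk,
      algebraMap_baseS_C_mul, ← hsucc, map_sum, smul_add, ← mul_smul, ← Polynomial.C_mul,
      add_assoc, ← eq_sub_iff_add_eq] at hE'
    have hmem : Polynomial.C (w k * c) • substLoc g F ((genAction F (.d k) ^ (n + 1)) u) ∈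
        cyclicSubmodule _ := by
      rw [hE']
      refine Submodule.sub_mem _ (Submodule.smul_mem _ _ ih) (Submodule.add_mem _
        (Submodule.smul_mem _ _ (Submodule.smul_mem _ _ ih)) (Submodule.sum_mem _ fun i hi => ?_))
      have hik := Finset.ne_of_mem_erase hi
      rw [map_smul, substLoc_smul, iterate_genAction_d_comm n (genAction_d_x_of_ne F hik.symm),
        iterate_genAction_d_comm n (genAction_d_d F k i)]
      exact Submodule.smul_mem _ _ (substLoc_genAction_x_mem hgk hg _
        (substLoc_genAction_d_mem he hgk hg hik ih))
    -- The only division: `w_k c` is a non-zero constant.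
    have h := Submodule.smul_mem _ (Polynomial.C (w k * c)⁻¹) hmem
    rwa [← mul_smul, ← Polynomial.C_mul, inv_mul_cancel₀ (mul_ne_zero hk hc), Polynomial.C_1,
      one_smul] at h

theorem bernsteinSato_aeval_dvd [Fintype σ] (he : Function.Injective e)
    (hgk : g k = MvPolynomial.C c)
    (hg : ∀ i : {i : σ // i ≠ k}, g i = MvPolynomial.X (e i)) (hc : c ≠ 0)
    {w : σ → K} {F : MvPolynomial σ K} (hw : IsQuasiHomogeneous w F) (hk : w k ≠ 0) :
    bernsteinSato (MvPolynomial.aeval g F : MvPolynomial τ K) ∣ bernsteinSato F := by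
  refine bernsteinSato_dvd_of_imp ?_
  rintro b ⟨P, hP⟩
  have h := weylSAction_mem F (specializeSubmodule g F k)
    (genAction_mem_specializeSubmodule he hgk hg) P _
    (baseS_mem_specializeSubmodule he hgk hg hc hw hk) 0
  rwa [hP, pow_zero, Module.End.one_apply, substLoc_algebraMap_polynomial] at h

end Specialize

end BernsteinSato

end

theorem proposition4p1 {K : Type*} [Field K] [CharZero K] {n : ℕ}
    (F : MvPolynomial (Fin n) K) (hF : F ≠ 0)
    (w : Fin n → K) (hw : BernsteinSato.IsQuasiHomogeneous w F)
    (k : Fin n) (hk : w k ≠ 0) (c : K) (hc : c ≠ 0) :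
    -- `f = F|_{x_k = c}` as a polynomial in the remaining variables
    BernsteinSato.bernsteinSato (BernsteinSato.substVar k c F) ∣
        BernsteinSato.bernsteinSato F ∧
    -- `f = F|_{x_k = c}` as a polynomial in all the variables, not involving `x_k`
    BernsteinSato.bernsteinSato
        (MvPolynomial.aeval (Function.update MvPolynomial.X k (MvPolynomial.C c)) F :
          MvPolynomial (Fin n) K) ∣
        BernsteinSato.bernsteinSato F := by
  constructor
  -- The target variables are the `i ≠ k` themselves here, and all of `Fin n` in the second case.
  · exact BernsteinSato.bernsteinSato_aeval_dvd (e := id) Function.injective_id (dif_pos rfl)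
      (fun i => dif_neg i.2) hc hw hk
  · exact BernsteinSato.bernsteinSato_aeval_dvd (e := Subtype.val) Subtype.val_injective
      (Function.update_self _ _ _) (fun i => Function.update_of_ne i.2 _ _) hc hw hk
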